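/- Let $\mathcal X=\mathbb R^2$, $\mathcal Y=\{0,1\}$, $\mathcal Z=\{u,v\}$. For mean vectors $\boldsymbol\mu=(\mu_{yz})_{y\in\mathcal Y,z\in\mathcal Z}$ in $\mathbb R^2$ let $P_z$ be the law of $(X,Y)$ with $P(Y=1)=P(Y=0)=\tfrac12$ and $X\mid Y=y\sim\mathcal N(\mu_{yz},I_2)$. Let $\mathcal F$ be the class of linear classifiers $x\mapsto \mathbf 1\{\langle w,x\rangle+b>0\}$, $w\in\mathbb R^2$, $b\in\mathbb R$, and put $L(z,f)=P_z(f(X)\neq Y)$, the expected $0$-$1$ loss. Let $\mathcal Q$ be the class of all problems given by such $\boldsymbol\mu$, with this $\mathcal F$ and the $0$-$1$ loss. For a probability vector $\pi$ on $\mathcal Z$ let $f_\pi\in\arg\min_{f\in\mathcal F}\sum_z\pi(z)L(z,f)$, and let $\pi^*\in\arg\min_\pi\max_z L(z,f_\pi)$. An adaptive sampling scheme $\mathcal A$ chooses in each round $t=1,\dots,n$ an attribute $z_t\in\mathcal Z$ as a (possibly randomized) measurable function of the previous rounds and receives an independent sample from $P_{z_t}$. Let $\pi_n(z)$ be the fraction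 of the $n$ rounds in which $z$ was chosen, and let $$\mathcal R_n(\mathcal A)=\max_{z}L(z,f_{\pi_n})-\max_z L(z,f_{\pi^*})$$ be the excess risk. Then $\max_{Q\in\mathcal Q}\mathbb E_Q[\mathcal R_n(\mathcal A)]=\Omega(1/\sqrt n)$. Precisely: there is an absolute constant $c>0$ such that for every budget $n\ge 1$ and every adaptive sampling scheme $\mathcal A$ there is a problem $Q\in\mathcal Q$ for which optimal classifiers $f_\pi$ exist for all $\pi$ and, for every choice of them, an optimal mixture $\pi^*$ exists and, for every choice of it, $\mathcal R_n(\mathcal A)$ is integrable with $$\mathbb E_Q[\mathcal R_n(\mathcal A)]\ \ge\ \frac{c}{\sqrt n}.$$ -/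

import Mathlib

open MeasureTheory ProbabilityTheory
open scoped ENNReal

noncomputable section

namespace FairSampling

/-- The feature space `ℝ²` with its Euclidean structure. -/
abbrev Plane := EuclideanSpace ℝ (Fin 2)

/-- The label set `{0, 1}`. -/
abbrev Label := Fin 2

/-- The attribute set `{u, v}`; `0` stands for `u` and `1` for `v`. -/
abbrev Attr := Fin 2

/-- A feature-label pair. -/
abbrev Sample := Plane × Label

/-- One round of an adaptive scheme: the queried attribute and the sample the oracle returned. -/
abbrev Round := Attr × Sample

/-- An instance of the synthetic model, given by its means `m y z`, for a label `y` and an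
attribute `z`. -/
abbrev MeanVectors := Label → Attr → Plane

/-- The feature-label law `P_z` of the instance `m`: the label is uniform on `{0, 1}`, and given
the label `y`, the feature has law `N(m y z, I₂)`. -/
def sampleLaw (m : MeanVectors) (z : Attr) : Measure Sample :=
  ∑ y : Label, (2 : ℝ≥0∞)⁻¹ • (multivariateGaussian (m y z) 1).prod (Measure.dirac y)

instance (m : MeanVectors) (z : Attr) : IsProbabilityMeasure (sampleLaw m z) := by
  constructor
  simp [sampleLaw, Fin.sum_univ_two, ENNReal.inv_two_add_inv_two]

/-- The oracle: asked with the attribute `z`, it returns an independent draw from `P_z`. -/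
def oracle (m : MeanVectors) : Kernel Attr Sample :=
  Kernel.ofFunOfCountable (sampleLaw m)

instance (m : MeanVectors) : IsMarkovKernel (oracle m) :=
  ⟨fun z => inferInstanceAs (IsProbabilityMeasure (sampleLaw m z))⟩

/-- The class of linear classifiers in two dimensions (with intercept). -/
def linearClassifiers : Set (Plane → Label) :=
  {f | ∃ (w : Plane) (b : ℝ), ∀ x, f x = if 0 < inner ℝ w x + b then 1 else 0}

/-- The `0`-`1` loss of the classifier `f` at the pair `(x, y)`. -/
def zeroOneLoss (f : Plane → Label) (x : Plane) (y : Label) : ℝ :=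
  if f x = y then 0 else 1

/-- `L(z, f)`, the expected loss of `f` under `P_z`. -/
def expectedLoss (m : MeanVectors) (z : Attr) (f : Plane → Label) : ℝ :=
  ∫ p, zeroOneLoss f p.1 p.2 ∂(sampleLaw m z)

/-- The loss of the worse-off attribute, `max_z L(z, f)`. -/
def worstLoss (m : MeanVectors) (f : Plane → Label) : ℝ :=
  max (expectedLoss m 0 f) (expectedLoss m 1 f)

/-- The expected loss of `f` under the mixture `π` of the attributes. -/
def mixtureLoss (m : MeanVectors) (π : Attr → ℝ) (f : Plane → Label) : ℝ :=
  ∑ z, π z * expectedLoss m z f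

/-- `f` is a `π`-optimal classifier: a linear classifier of minimal loss under the mixture `π`. -/
def IsOptimalClassifier (m : MeanVectors) (π : Attr → ℝ) (f : Plane → Label) : Prop :=
  f ∈ linearClassifiers ∧ ∀ g ∈ linearClassifiers, mixtureLoss m π f ≤ mixtureLoss m π g

/-- `f` assigns to every mixture distribution `π` some `π`-optimal classifier `f_π`. -/
def IsOptimalSelection (m : MeanVectors) (f : (Attr → ℝ) → Plane → Label) : Prop :=
  ∀ π ∈ stdSimplex ℝ Attr, IsOptimalClassifier m π (f π)

/-- `π'` minimizes `max_z L(z, f_π)` over the mixture distributions `π`. -/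
def IsFairestMixture (m : MeanVectors) (f : (Attr → ℝ) → Plane → Label) (π' : Attr → ℝ) : Prop :=
  π' ∈ stdSimplex ℝ Attr ∧ ∀ π ∈ stdSimplex ℝ Attr, worstLoss m (f π') ≤ worstLoss m (f π)

/-- An adaptive sampling scheme: the attribute to query next is drawn from a law that depends
measurably on the rounds so far. Deterministic schemes are those whose laws are Dirac masses. -/
structure SamplingScheme where
  /-- the law of the next attribute after `t` rounds -/
  query : (t : ℕ) → Kernel (Fin t → Round) Attr
  /-- these laws are probability measures -/
  isMarkovKernel : ∀ t, IsMarkovKernel (query t)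

instance (A : SamplingScheme) (t : ℕ) : IsMarkovKernel (A.query t) := A.isMarkovKernel t

/-- The law of the first `t` rounds when the scheme `A` is run on the instance `m`. -/
def historyLaw (m : MeanVectors) (A : SamplingScheme) : (t : ℕ) → Measure (Fin t → Round)
  | 0 => Measure.dirac (fun i => i.elim0)
  | t + 1 =>
    (historyLaw m A t ⊗ₘ (A.query t ⊗ₖ Kernel.prodMkLeft (Fin t → Round) (oracle m))).map
      (fun p => (Fin.snoc p.1 p.2 : Fin (t + 1) → Round))

theorem measurable_snoc (t : ℕ) :
    Measurable (fun p : (Fin t → Round) × Round => (Fin.snoc p.1 p.2 : Fin (t + 1) → Round)) := by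
  rw [measurable_pi_iff]
  intro i
  refine Fin.lastCases ?_ (fun j => ?_) i
  · simpa using measurable_snd
  · simp only [Fin.snoc_castSucc]
    exact (measurable_pi_apply j).comp measurable_fst

instance (m : MeanVectors) (A : SamplingScheme) (t : ℕ) :
    IsProbabilityMeasure (historyLaw m A t) := by
  induction t with
  | zero => simp only [historyLaw]; infer_instance
  | succ t ih =>
    simp only [historyLaw]
    exact Measure.isProbabilityMeasure_map (measurable_snoc t).aemeasurable

/-- The empirical mixture distribution `π_n` of the rounds `h`: `π_n(z)` is the fraction of rounds
in which `z` was queried. -/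
def empiricalMixture {n : ℕ} (h : Fin n → Round) (z : Attr) : ℝ :=
  ((Finset.univ.filter (fun t => (h t).1 = z)).card : ℝ) / n

/-- The excess risk `max_z L(z, f_{π_n}) - max_z L(z, f_{π'})` of the rounds `h`, where `π'` is a
fairest mixture. -/
def excessRisk (m : MeanVectors) (f : (Attr → ℝ) → Plane → Label) (π' : Attr → ℝ) {n : ℕ}
    (h : Fin n → Round) : ℝ :=
  worstLoss m (f (empiricalMixture h)) - worstLoss m (f π')

end FairSampling

end

/-!
The lower bound is a two-point argument. Both instances have antipodal means `± a z • e_z` on the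
coordinate axes, with signal strengths `1 / 2` and `1 / 2 + ε`, where `ε = 1 / (2 * √n)`; they
differ in which attribute has the weaker signal.

**Risk.** Let `T = gaussianTail`. A linear classifier with unit weight `w` and no intercept has
loss `T (a z * w z)` on the attribute `z`; intercepts and negative weights only increase the losses
(`gaussianTail_le_midpoint`). So classifiers reduce to points of `quarterDisc`, and optimal ones
exist by compactness. The worst loss is smallest where the two margins `a z * w z` coincide
(`le_worstLoss`). Since `T` is strictly convex on `[0, ∞)`, every optimal classifier for the
explicit mixture `fairMixture` is of this kind
(`worstLoss_eq_of_isOptimalClassifier_fairMixture`); hence fairest mixtures exist and have the worst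
loss `T (fairMargin a)`, whatever selection of optimal classifiers is given. If the harder attribute
has at most half of the weight, an optimal classifier cannot favour it, as swapping the two
coordinates of `w` would then lower the mixture loss (`le_expectedLoss_of_weight_le`, through
`gaussianTail_gain_lt`). Its loss is then at least `T (a z / √2)`, which exceeds
`T (fairMargin a)` by a constant times `ε`.

**Information.** The domination `(∫ g dP)² ≤ K ∫ g² dQ` (`ChiSqDominated`) passes to composition
products, and for Gaussians of unit covariance it holds with `K` the exponential of the squared
distance of the means. Thus the two histories of length `n` are dominated with the constant
`exp (n * ε ^ 2) = exp (1 / 4)` (`chiSqDominated_historyLaw`), for every scheme. The events that one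
or the other attribute gets at most half of the rounds cover everything, so that under one of the
two instances its harder attribute gets at most half of the rounds with probability bounded below
(`ChiSqDominated.le_measureReal_or`).
-/

namespace FairSampling

/-! ### The standard normal tail -/

/-- The standard normal tail `t ↦ P(N(0, 1) > t)`. -/
noncomputable def gaussianTail (t : ℝ) : ℝ := (gaussianReal 0 1).real (Set.Ioi t)

theorem gaussianTail_eq_integral (t : ℝ) :
    gaussianTail t = ∫ x in Set.Ioi t, gaussianPDFReal 0 1 x := by
  rw [gaussianTail, measureReal_def, gaussianReal_apply_eq_integral 0 one_ne_zero,
    ENNReal.toReal_ofReal (integral_nonneg fun x => gaussianPDFReal_nonneg 0 1 x)]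

theorem continuous_stdPDF : Continuous (gaussianPDFReal 0 1) := by
  unfold gaussianPDFReal; fun_prop

theorem gaussianTail_sub (s t : ℝ) :
    gaussianTail s - gaussianTail t = ∫ x in s..t, gaussianPDFReal 0 1 x := by
  have hi := integrable_gaussianPDFReal 0 1
  rw [gaussianTail_eq_integral, gaussianTail_eq_integral,
    intervalIntegral.integral_Ioi_sub_Ioi' hi.integrableOn hi.integrableOn]

theorem hasDerivAt_gaussianTail (t : ℝ) :
    HasDerivAt gaussianTail (-gaussianPDFReal 0 1 t) t := by
  have h : gaussianTail = fun s => gaussianTail 0 - ∫ x in (0 : ℝ)..s, gaussianPDFReal 0 1 x := by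
    ext s; rw [← gaussianTail_sub]; ring
  rw [h]
  exact (continuous_stdPDF.integral_hasStrictDerivAt 0 t).hasDerivAt.const_sub _

theorem continuous_gaussianTail : Continuous gaussianTail :=
  continuous_iff_continuousAt.2 fun t => (hasDerivAt_gaussianTail t).continuousAt

theorem strictAnti_gaussianTail : StrictAnti gaussianTail :=
  strictAnti_of_hasDerivAt_neg hasDerivAt_gaussianTail
    fun t => neg_lt_zero.2 (gaussianPDFReal_pos 0 1 t one_ne_zero)

theorem stdPDF_eq (x : ℝ) :
    gaussianPDFReal 0 1 x = (√(2 * Real.pi))⁻¹ * Real.exp (-(x ^ 2 / 2)) := by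
  simp [gaussianPDFReal, neg_div]

theorem stdPDF_le_of_sq_le {x y : ℝ} (h : x ^ 2 ≤ y ^ 2) :
    gaussianPDFReal 0 1 y ≤ gaussianPDFReal 0 1 x := by
  rw [stdPDF_eq, stdPDF_eq]
  gcongr

theorem stdPDF_lt_of_sq_lt {x y : ℝ} (h : x ^ 2 < y ^ 2) :
    gaussianPDFReal 0 1 y < gaussianPDFReal 0 1 x := by
  rw [stdPDF_eq, stdPDF_eq]
  gcongr

theorem measureReal_Ioi_gaussianReal (m t : ℝ) :
    (gaussianReal m 1).real (Set.Ioi t) = gaussianTail (t - m) := by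
  have h := gaussianReal_map_const_add (μ := 0) (v := 1) m
  rw [zero_add] at h
  rw [gaussianTail, ← h, map_measureReal_apply (by fun_prop) measurableSet_Ioi]
  congr 1
  ext x
  simp [sub_lt_iff_lt_add']

theorem measureReal_Iic_gaussianReal (m t : ℝ) :
    (gaussianReal m 1).real (Set.Iic t) = gaussianTail (m - t) := by
  have h := gaussianReal_map_neg (μ := m) (v := 1)
  have := nullSingletonClass_gaussianReal (μ := m) (v := 1) one_ne_zero
  rw [show m - t = -t - -m by ring, ← measureReal_Ioi_gaussianReal, ← h,
    map_measureReal_apply (by fun_prop) measurableSet_Ioi,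
    measureReal_congr (Iio_ae_eq_Iic (μ := gaussianReal m 1) (a := t)).symm]
  congr 1
  ext x
  simp

theorem gaussianTail_neg (t : ℝ) : gaussianTail (-t) = 1 - gaussianTail t := by
  have h := measureReal_Iic_gaussianReal 0 t
  rw [zero_sub] at h
  rw [← h, gaussianTail, ← probReal_compl_eq_one_sub measurableSet_Ioi, Set.compl_Ioi]

theorem gaussianTail_zero : gaussianTail 0 = 1 / 2 := by
  have h := gaussianTail_neg 0
  rw [neg_zero] at h
  linarith

/-- Every margin is at least as good without an intercept: the density is larger on
`[s - b, s]` than on its mirror image `[s, s + b]`. -/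
theorem gaussianTail_le_midpoint {s : ℝ} (hs : 0 ≤ s) (b : ℝ) :
    gaussianTail s ≤ (gaussianTail (s + b) + gaussianTail (s - b)) / 2 := by
  wlog hb : 0 ≤ b generalizing b
  · have := this (-b) (by linarith)
    rwa [sub_neg_eq_add, ← sub_eq_add_neg, add_comm] at this
  have h1 : gaussianTail (s - b) - gaussianTail s
      = ∫ x in (0 : ℝ)..b, gaussianPDFReal 0 1 (s - x) := by
    rw [gaussianTail_sub, intervalIntegral.integral_comp_sub_left]; simp
  have h2 : gaussianTail s - gaussianTail (s + b)
      = ∫ x in (0 : ℝ)..b, gaussianPDFReal 0 1 (s + x) := by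
    rw [gaussianTail_sub, intervalIntegral.integral_comp_add_left]; simp
  have h3 : ∫ x in (0 : ℝ)..b, gaussianPDFReal 0 1 (s + x)
      ≤ ∫ x in (0 : ℝ)..b, gaussianPDFReal 0 1 (s - x) :=
    intervalIntegral.integral_mono_on hb
      ((continuous_stdPDF.comp (by fun_prop)).intervalIntegrable 0 b)
      ((continuous_stdPDF.comp (by fun_prop)).intervalIntegrable 0 b)
      fun x hx => stdPDF_le_of_sq_le (by nlinarith [hx.1, mul_nonneg hs hx.1])
  linarith

/-- The tail is strictly convex on `[0, ∞)`, so it lies strictly above its tangents there. -/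
theorem tangent_lt_gaussianTail {s t : ℝ} (hs : 0 ≤ s) (ht : 0 ≤ t) (hne : t ≠ s) :
    gaussianTail s - gaussianPDFReal 0 1 s * (t - s) < gaussianTail t := by
  rcases lt_or_gt_of_ne hne with h | h
  · obtain ⟨x, hx, hx'⟩ := exists_hasDerivAt_eq_slope gaussianTail _ h
      continuous_gaussianTail.continuousOn fun x _ => hasDerivAt_gaussianTail x
    have hp := stdPDF_lt_of_sq_lt (show x ^ 2 < s ^ 2 by nlinarith [hx.1, hx.2])
    rw [eq_div_iff (by linarith)] at hx'
    nlinarith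
  · obtain ⟨x, hx, hx'⟩ := exists_hasDerivAt_eq_slope gaussianTail _ h
      continuous_gaussianTail.continuousOn fun x _ => hasDerivAt_gaussianTail x
    have hp := stdPDF_lt_of_sq_lt (show s ^ 2 < x ^ 2 by nlinarith [hx.1, hx.2])
    rw [eq_div_iff (by linarith)] at hx'
    nlinarith

theorem tangent_le_gaussianTail {s t : ℝ} (hs : 0 ≤ s) (ht : 0 ≤ t) :
    gaussianTail s - gaussianPDFReal 0 1 s * (t - s) ≤ gaussianTail t := by
  rcases eq_or_ne t s with rfl | h
  · simp
  · exact (tangent_lt_gaussianTail hs ht h).le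

/-- For fixed `t`, the quantity `x * φ (x * t)` is strictly increasing in `x` as long as
`x * t ≤ 1`. -/
theorem mul_stdPDF_lt {a b t : ℝ} (ha : 0 < a) (hab : a < b) (ht : 0 ≤ t) (hbt : b * t ≤ 1) :
    a * gaussianPDFReal 0 1 (a * t) < b * gaussianPDFReal 0 1 (b * t) := by
  have hb : 0 < b := ha.trans hab
  have hu : (b * t) ^ 2 ≤ 1 := by
    have : 0 ≤ b * t := by positivity
    nlinarith
  have hr : a ^ 2 / b ^ 2 ≤ 1 := by
    rw [div_le_one (by positivity)]; nlinarith
  -- With `r = a / b`, the bound `1 - y ≤ exp (-y)` reduces the claim to `2 r < 1 + r ^ 2`.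
  have hy : 1 - (1 - a ^ 2 / b ^ 2) / 2 ≤
      Real.exp (-((b * t) ^ 2 / 2) - -((a * t) ^ 2 / 2)) := by
    refine le_trans ?_ (Real.add_one_le_exp _)
    have : (a * t) ^ 2 = a ^ 2 / b ^ 2 * (b * t) ^ 2 := by field_simp
    rw [this]
    nlinarith
  have hlt : a < b * (1 - (1 - a ^ 2 / b ^ 2) / 2) := by
    have : b * (1 - (1 - a ^ 2 / b ^ 2) / 2) - a = (b - a) ^ 2 / (2 * b) := by
      field_simp; ring
    have h2 : 0 < (b - a) ^ 2 / (2 * b) := by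
      have : 0 < b - a := by linarith
      positivity
    linarith
  have hexp : a * Real.exp (-((a * t) ^ 2 / 2)) < b * Real.exp (-((b * t) ^ 2 / 2)) := by
    have he := Real.exp_pos (-((a * t) ^ 2 / 2))
    calc a * Real.exp (-((a * t) ^ 2 / 2))
        < b * Real.exp (-((b * t) ^ 2 / 2) - -((a * t) ^ 2 / 2))
            * Real.exp (-((a * t) ^ 2 / 2)) := by
          gcongr
          exact hlt.trans_le (by gcongr)
      _ = b * Real.exp (-((b * t) ^ 2 / 2)) := by
          rw [mul_assoc, ← Real.exp_add]; ring_nf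
  rw [stdPDF_eq, stdPDF_eq]
  have : 0 < (√(2 * Real.pi))⁻¹ := by positivity
  nlinarith

/-- Raising the margin from `p` to `q` pays off more at the larger signal strength `b`. -/
theorem gaussianTail_gain_lt {a b p q : ℝ} (ha : 0 < a) (hab : a < b) (hp : 0 ≤ p) (hpq : p < q)
    (hbq : b * q ≤ 1) :
    gaussianTail (a * p) - gaussianTail (a * q) < gaussianTail (b * p) - gaussianTail (b * q) := by
  have hd (x t : ℝ) : HasDerivAt (fun t => gaussianTail (x * t))
      (-gaussianPDFReal 0 1 (x * t) * x) t := by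
    have := (hasDerivAt_gaussianTail (x * t)).comp t ((hasDerivAt_id t).const_mul x)
    simpa [Function.comp_def] using this
  have hd' (t : ℝ) := (hd b t).sub (hd a t)
  obtain ⟨t, ht, hs⟩ := exists_hasDerivAt_eq_slope _ _ hpq
    (fun t _ => (hd' t).continuousAt.continuousWithinAt) fun t _ => hd' t
  have hlt := mul_stdPDF_lt ha hab (hp.trans ht.1.le)
    ((mul_le_mul_of_nonneg_left ht.2.le (ha.trans hab).le).trans hbq)
  rw [eq_div_iff (by linarith)] at hs
  simp only [Pi.sub_apply] at hs
  nlinarith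

theorem stdPDF_one_mul_le_gaussianTail_sub {s t : ℝ} (hs : 0 ≤ s) (hst : s ≤ t) (ht : t ≤ 1) :
    gaussianPDFReal 0 1 1 * (t - s) ≤ gaussianTail s - gaussianTail t := by
  have h := tangent_le_gaussianTail (hs.trans hst) hs
  have hp := stdPDF_le_of_sq_le (show t ^ 2 ≤ 1 ^ 2 by nlinarith)
  nlinarith

/-! ### Chi-square domination of adaptively collected data -/

/-- `(∫ g dP)² ≤ K ∫ g² dQ` for all nonnegative measurable `g`. For `P ≪ Q` this says that the
likelihood ratio has second moment at most `K` under `Q`, i.e. `1 + χ²(P ‖ Q) ≤ K`; the dual form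
tensorizes without any mention of densities. -/
def ChiSqDominated {α : Type*} [MeasurableSpace α] (K : ℝ≥0∞) (P Q : Measure α) : Prop :=
  ∀ g : α → ℝ≥0∞, Measurable g → (∫⁻ x, g x ∂P) ^ 2 ≤ K * ∫⁻ x, g x ^ 2 ∂Q

section ChiSq

variable {α β : Type*} [MeasurableSpace α] [MeasurableSpace β]

theorem sq_lintegral_mul_le (P : Measure α) {f g : α → ℝ≥0∞} (hf : Measurable f)
    (hg : Measurable g) :
    (∫⁻ x, f x * g x ∂P) ^ 2 ≤ (∫⁻ x, f x ^ 2 ∂P) * ∫⁻ x, g x ^ 2 ∂P := by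
  have h := ENNReal.lintegral_mul_le_Lp_mul_Lq P Real.HolderConjugate.two_two
    hf.aemeasurable hg.aemeasurable
  simp only [Pi.mul_apply, ENNReal.rpow_two] at h
  calc (∫⁻ x, f x * g x ∂P) ^ 2
      ≤ ((∫⁻ x, f x ^ 2 ∂P) ^ (1 / 2 : ℝ) * (∫⁻ x, g x ^ 2 ∂P) ^ (1 / 2 : ℝ)) ^ 2 := by gcongr
    _ = _ := by
      rw [mul_pow, ← ENNReal.rpow_two, ← ENNReal.rpow_two, ← ENNReal.rpow_mul, ← ENNReal.rpow_mul]
      norm_num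

theorem ChiSqDominated.refl (P : Measure α) [IsProbabilityMeasure P] : ChiSqDominated 1 P P := by
  intro g hg
  simpa using sq_lintegral_mul_le P measurable_const (f := fun _ => 1) hg

theorem ChiSqDominated.map {K : ℝ≥0∞} {P Q : Measure α} (h : ChiSqDominated K P Q) {f : α → β}
    (hf : Measurable f) : ChiSqDominated K (P.map f) (Q.map f) := by
  intro g hg
  rw [lintegral_map hg hf, lintegral_map (hg.pow_const 2) hf]
  exact h _ (hg.comp hf)

theorem ChiSqDominated.compProd {K K' : ℝ≥0∞} {P Q : Measure α} [SFinite P] [SFinite Q]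
    {κ η : Kernel α β} [IsSFiniteKernel κ] [IsSFiniteKernel η] (h : ChiSqDominated K P Q)
    (h' : ∀ a, ChiSqDominated K' (κ a) (η a)) : ChiSqDominated (K * K') (P ⊗ₘ κ) (Q ⊗ₘ η) := by
  intro g hg
  rw [Measure.lintegral_compProd hg, Measure.lintegral_compProd (hg.pow_const 2)]
  have hm : Measurable fun a => ∫⁻ b, g (a, b) ^ 2 ∂η a :=
    (hg.pow_const 2).lintegral_kernel_prod_right'
  calc (∫⁻ a, ∫⁻ b, g (a, b) ∂κ a ∂P) ^ 2
      ≤ K * ∫⁻ a, (∫⁻ b, g (a, b) ∂κ a) ^ 2 ∂Q := h _ hg.lintegral_kernel_prod_right'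
    _ ≤ K * ∫⁻ a, K' * ∫⁻ b, g (a, b) ^ 2 ∂η a ∂Q := by
      gcongr with a
      exact h' a _ (hg.comp measurable_prodMk_left)
    _ = K * K' * ∫⁻ a, ∫⁻ b, g (a, b) ^ 2 ∂η a ∂Q := by
      rw [lintegral_const_mul _ hm, mul_assoc]

theorem ChiSqDominated.prod {K K' : ℝ≥0∞} {P Q : Measure α} {P' Q' : Measure β}
    [SFinite P] [SFinite Q] [SFinite P'] [SFinite Q'] (h : ChiSqDominated K P Q)
    (h' : ChiSqDominated K' P' Q') : ChiSqDominated (K * K') (P.prod P') (Q.prod Q') := by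
  rw [← Measure.compProd_const, ← Measure.compProd_const]
  exact h.compProd fun _ => by simpa using h'

theorem ChiSqDominated.half_add_half {K : ℝ≥0∞} {P Q P' Q' : Measure α}
    (h : ChiSqDominated K P Q) (h' : ChiSqDominated K P' Q') :
    ChiSqDominated K ((2 : ℝ≥0∞)⁻¹ • P + (2 : ℝ≥0∞)⁻¹ • P')
      ((2 : ℝ≥0∞)⁻¹ • Q + (2 : ℝ≥0∞)⁻¹ • Q') := by
  intro g hg
  simp only [lintegral_add_measure, lintegral_smul_measure, smul_eq_mul]
  set x := ∫⁻ a, g a ∂P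
  set y := ∫⁻ a, g a ∂P'
  calc (2⁻¹ * x + 2⁻¹ * y) ^ 2 ≤ 2⁻¹ * x ^ 2 + 2⁻¹ * y ^ 2 := by
        have := ENNReal.rpow_arith_mean_le_arith_mean2_rpow 2⁻¹ 2⁻¹ x y
          ENNReal.inv_two_add_inv_two one_le_two
        simpa only [ENNReal.rpow_two] using this
    _ ≤ 2⁻¹ * (K * ∫⁻ a, g a ^ 2 ∂Q) + 2⁻¹ * (K * ∫⁻ a, g a ^ 2 ∂Q') := by
        gcongr
        · exact h g hg
        · exact h' g hg
    _ = _ := by ring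

theorem ChiSqDominated.sq_measure_le {K : ℝ≥0∞} {P Q : Measure α} (h : ChiSqDominated K P Q)
    {s : Set α} (hs : MeasurableSet s) : P s ^ 2 ≤ K * Q s := by
  have := h (s.indicator 1) (measurable_one.indicator hs)
  have e : (fun x => s.indicator (1 : α → ℝ≥0∞) x ^ 2) = s.indicator 1 := by
    ext x; by_cases hx : x ∈ s <;> simp [hx]
  rwa [e, lintegral_indicator_one hs, lintegral_indicator_one hs] at this

theorem chiSqDominated_gaussianReal (a b : ℝ) :
    ChiSqDominated (ENNReal.ofReal (Real.exp ((a - b) ^ 2))) (gaussianReal a 1)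
      (gaussianReal b 1) := by
  intro g hg
  let ρ : ℝ → ℝ := fun x => Real.exp ((a - b) * x - (a ^ 2 - b ^ 2) / 2)
  have hρ : Measurable fun x => ENNReal.ofReal (ρ x) := by unfold ρ; fun_prop
  have hpdf (x : ℝ) : gaussianPDF a 1 x = gaussianPDF b 1 x * ENNReal.ofReal (ρ x) := by
    rw [gaussianPDF, gaussianPDF, ← ENNReal.ofReal_mul (gaussianPDFReal_nonneg _ _ _)]
    simp only [gaussianPDFReal, ρ]
    rw [mul_assoc (√_)⁻¹, ← Real.exp_add]
    congr 3
    simp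
    ring
  have hchange : ∫⁻ x, g x ∂gaussianReal a 1
      = ∫⁻ x, ENNReal.ofReal (ρ x) * g x ∂gaussianReal b 1 := by
    rw [gaussianReal_of_var_ne_zero a one_ne_zero, gaussianReal_of_var_ne_zero b one_ne_zero,
      lintegral_withDensity_eq_lintegral_mul _ (measurable_gaussianPDF a 1) hg,
      lintegral_withDensity_eq_lintegral_mul _ (measurable_gaussianPDF b 1)
        (g := fun x => ENNReal.ofReal (ρ x) * g x) (hρ.mul hg)]
    simp only [Pi.mul_apply, hpdf, mul_assoc]
  have hsq : ∫⁻ x, ENNReal.ofReal (ρ x) ^ 2 ∂gaussianReal b 1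
      = ENNReal.ofReal (Real.exp ((a - b) ^ 2)) := by
    have e (x : ℝ) : ENNReal.ofReal (ρ x) ^ 2
        = ENNReal.ofReal (Real.exp (-(a ^ 2 - b ^ 2)) * Real.exp (2 * (a - b) * x)) := by
      rw [← ENNReal.ofReal_pow (Real.exp_nonneg _), ← Real.exp_nat_mul, ← Real.exp_add]
      congr 2
      push_cast
      ring
    simp only [e]
    rw [← ofReal_integral_eq_lintegral_ofReal
      ((integrable_exp_mul_gaussianReal _).const_mul _)
      (Filter.Eventually.of_forall fun x => by positivity), integral_const_mul]
    have := congrFun (mgf_fun_id_gaussianReal (μ := b) (v := 1)) (2 * (a - b))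
    rw [mgf] at this
    rw [this, ← Real.exp_add]
    congr 2
    push_cast
    ring
  rw [hchange, ← hsq]
  exact sq_lintegral_mul_le _ hρ hg

theorem multivariateGaussian_one_eq (μ : Plane) :
    multivariateGaussian μ 1 =
      ((gaussianReal (μ 0) 1).prod (gaussianReal (μ 1) 1)).map (fun p => !₂[p.1, p.2]) := by
  have h1 := (measurePreserving_finTwoArrow_vec (gaussianReal 0 1) (gaussianReal 0 1)).symm.map_eq
  have h0 : (Measure.pi fun _ : Fin 2 => gaussianReal 0 1)
      = Measure.pi ![gaussianReal 0 1, gaussianReal 0 1] := by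
    congr 1; ext i; fin_cases i <;> rfl
  have h2 (c : ℝ) := gaussianReal_map_const_add (μ := 0) (v := 1) c
  simp only [zero_add] at h2
  rw [multivariateGaussian, ← map_pi_eq_stdGaussian, h0, ← h1, ← h2 (μ 0), ← h2 (μ 1),
    Measure.map_prod_map _ _ (by fun_prop) (by fun_prop), Measure.map_map (by fun_prop) (by fun_prop),
    Measure.map_map (by fun_prop) (by fun_prop), Measure.map_map (by fun_prop) (by fun_prop)]
  congr 1
  ext p i
  fin_cases i <;> simp [MeasurableEquiv.finTwoArrow]

theorem chiSqDominated_multivariateGaussian (μ ν : Plane) :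
    ChiSqDominated (ENNReal.ofReal (Real.exp (‖μ - ν‖ ^ 2)))
      (multivariateGaussian μ 1) (multivariateGaussian ν 1) := by
  rw [multivariateGaussian_one_eq, multivariateGaussian_one_eq, EuclideanSpace.real_norm_sq_eq,
    Fin.sum_univ_two, Real.exp_add, ENNReal.ofReal_mul (Real.exp_nonneg _)]
  exact ((chiSqDominated_gaussianReal _ _).prod (chiSqDominated_gaussianReal _ _)).map
    (by fun_prop)

theorem chiSqDominated_sampleLaw {m m' : MeanVectors} {z : Attr} {d : ℝ}
    (h : ∀ y, ‖m y z - m' y z‖ ^ 2 ≤ d) :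
    ChiSqDominated (ENNReal.ofReal (Real.exp d)) (sampleLaw m z) (sampleLaw m' z) := by
  have key (y : Label) : ChiSqDominated (ENNReal.ofReal (Real.exp d))
      ((multivariateGaussian (m y z) 1).prod (Measure.dirac y))
      ((multivariateGaussian (m' y z) 1).prod (Measure.dirac y)) := by
    intro g hg
    refine ((chiSqDominated_multivariateGaussian _ (m' y z)).prod (.refl (.dirac y)) g hg).trans ?_
    rw [mul_one]
    gcongr
    exact h y
  rw [sampleLaw, sampleLaw, Fin.sum_univ_two, Fin.sum_univ_two]
  exact (key 0).half_add_half (key 1)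

/-- However the attributes are chosen, the chi-square constant of `t` rounds is at most the `t`-th
power of that of a single sample. The laws of the queries are common to both instances and so cost
nothing. -/
theorem chiSqDominated_historyLaw {m m' : MeanVectors} {K : ℝ≥0∞}
    (h : ∀ z, ChiSqDominated K (sampleLaw m z) (sampleLaw m' z)) (A : SamplingScheme) (t : ℕ) :
    ChiSqDominated (K ^ t) (historyLaw m A t) (historyLaw m' A t) := by
  induction t with
  | zero => simpa [historyLaw] using ChiSqDominated.refl (α := Fin 0 → Round) (Measure.dirac _)
  | succ t ih =>
    rw [historyLaw, historyLaw, pow_succ]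
    refine (ih.compProd fun a => ?_).map (measurable_snoc t)
    rw [Kernel.compProd_apply_eq_compProd_sectR, Kernel.compProd_apply_eq_compProd_sectR]
    have := (ChiSqDominated.refl (A.query t a)).compProd (κ := oracle m) (η := oracle m') h
    rw [one_mul] at this
    -- The oracle ignores the history.
    have hs (m : MeanVectors) :
        (Kernel.prodMkLeft (Fin t → Round) (oracle m)).sectR a = oracle m := by
      ext z : 1; simp
    rwa [hs, hs]

end ChiSq

/-! ### Losses of linear classifiers -/

theorem expectedLoss_eq (m : MeanVectors) (z : Attr) {f : Plane → Label} (hf : Measurable f) :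
    expectedLoss m z f = ((multivariateGaussian (m 0 z) 1).real {x | f x ≠ 0}
      + (multivariateGaussian (m 1 z) 1).real {x | f x ≠ 1}) / 2 := by
  have hmeas : MeasurableSet {p : Sample | f p.1 ≠ p.2} :=
    (measurableSet_eq_fun (hf.comp measurable_fst) measurable_snd).compl
  have hloss : (fun p : Sample => zeroOneLoss f p.1 p.2)
      = {p : Sample | f p.1 ≠ p.2}.indicator 1 := by
    ext p; by_cases h : f p.1 = p.2 <;> simp [zeroOneLoss, h]
  have hy (y : Label) : ((multivariateGaussian (m y z) 1).prod (Measure.dirac y))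
      {p : Sample | f p.1 ≠ p.2} = multivariateGaussian (m y z) 1 {x | f x ≠ y} := by
    rw [Measure.prod_dirac, Measure.map_apply (by fun_prop) hmeas]
    rfl
  have hfin (μ : Measure Plane) [IsProbabilityMeasure μ] (s : Set Plane) :
      (2 : ℝ≥0∞)⁻¹ * μ s ≠ ∞ := ENNReal.mul_ne_top (by simp) (measure_ne_top _ _)
  rw [expectedLoss, hloss, integral_indicator_one hmeas, sampleLaw, Fin.sum_univ_two,
    measureReal_def, Measure.add_apply, Measure.smul_apply, Measure.smul_apply, smul_eq_mul,
    smul_eq_mul, hy, hy, ENNReal.toReal_add (hfin _ _) (hfin _ _), ENNReal.toReal_mul,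
    ENNReal.toReal_mul, ENNReal.toReal_inv, ENNReal.toReal_ofNat, measureReal_def, measureReal_def]
  ring

theorem map_inner_multivariateGaussian {w : Plane} (hw : ‖w‖ = 1) (μ : Plane) :
    (multivariateGaussian μ 1).map (fun x => inner ℝ w x) = gaussianReal (inner ℝ w μ) 1 := by
  have h := IsGaussian.map_eq_gaussianReal (μ := multivariateGaussian μ 1) (innerSL ℝ w)
  have hvar : Var[innerSL ℝ w; multivariateGaussian μ 1] = 1 := by
    have hmap : multivariateGaussian μ 1 = (stdGaussian Plane).map (fun x => μ + x) := by
      simp [multivariateGaussian]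
    have hcomp : innerSL ℝ w ∘ (fun x => μ + x) = fun x => inner ℝ w μ + innerSL ℝ w x := by
      ext x; simp [inner_add_right]
    rw [hmap, variance_map (by fun_prop) (by fun_prop), hcomp, variance_const_add (by fun_prop), variance_dual_stdGaussian, innerSL_apply_norm, hw]
    norm_num
  rw [(innerSL ℝ w).integral_comp_id_comm IsGaussian.integrable_id,
    integral_id_multivariateGaussian, hvar] at h
  simpa using h

/-- The linear classifier with weight `w` and intercept `b`. -/
noncomputable def linearClassifier (w : Plane) (b : ℝ) (x : Plane) : Label :=
  if 0 < inner ℝ w x + b then 1 else 0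

theorem measurable_linearClassifier (w : Plane) (b : ℝ) : Measurable (linearClassifier w b) :=
  Measurable.ite (measurableSet_lt (by fun_prop) (by fun_prop)) measurable_const measurable_const

theorem linearClassifier_mem (w : Plane) (b : ℝ) : linearClassifier w b ∈ linearClassifiers :=
  ⟨w, b, fun _ => rfl⟩

theorem expectedLoss_linearClassifier (m : MeanVectors) (z : Attr) {w : Plane} (hw : ‖w‖ = 1)
    (b : ℝ) : expectedLoss m z (linearClassifier w b)
      = (gaussianTail (-(inner ℝ w (m 0 z) + b)) + gaussianTail (inner ℝ w (m 1 z) + b)) / 2 := by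
  have h0 : {x | linearClassifier w b x ≠ 0} = (fun x => inner ℝ w x) ⁻¹' Set.Ioi (-b) := by
    ext x
    by_cases h : 0 < inner ℝ w x + b <;> simp [linearClassifier, h] <;> linarith
  have h1 : {x | linearClassifier w b x ≠ 1} = (fun x => inner ℝ w x) ⁻¹' Set.Iic (-b) := by
    ext x
    simp [linearClassifier, le_neg_iff_add_nonpos_right]
  rw [expectedLoss_eq m z (measurable_linearClassifier w b), h0, h1,
    ← map_measureReal_apply (by fun_prop) measurableSet_Ioi,
    ← map_measureReal_apply (by fun_prop) measurableSet_Iic,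
    map_inner_multivariateGaussian hw, map_inner_multivariateGaussian hw,
    measureReal_Ioi_gaussianReal, measureReal_Iic_gaussianReal]
  congr 3 <;> ring

theorem expectedLoss_const (m : MeanVectors) (z : Attr) (y : Label) :
    expectedLoss m z (fun _ => y) = 1 / 2 := by
  rw [expectedLoss_eq m z measurable_const]
  fin_cases y <;> simp

/-! ### Instances with antipodal means on the coordinate axes -/

/-- The instance in which, given the attribute `z`, the labels `1` and `0` have the means
`± a z • e_z`, where `e_z` is the coordinate vector of `z`. -/
noncomputable def axisMeans (a : Attr → ℝ) : MeanVectors := fun y z =>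
  EuclideanSpace.single z (if y = 1 then a z else -a z)

/-- The nonnegative part of the unit disc. Up to a deterioration of the losses, a linear
classifier for `axisMeans a` is a point `v` of it, with loss `gaussianTail (a z * v z)` on the
attribute `z`. -/
def quarterDisc : Set (Attr → ℝ) := {v | (∀ z, 0 ≤ v z) ∧ v 0 ^ 2 + v 1 ^ 2 ≤ 1}

theorem expectedLoss_axisMeans (a : Attr → ℝ) (z : Attr) {w : Plane} (hw : ‖w‖ = 1) (b : ℝ) :
    expectedLoss (axisMeans a) z (linearClassifier w b)
      = (gaussianTail (a z * w z + b) + gaussianTail (a z * w z - b)) / 2 := by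
  rw [expectedLoss_linearClassifier _ _ hw]
  simp only [axisMeans, EuclideanSpace.inner_single_right]
  simp
  ring_nf

theorem norm_sq_plane (w : Plane) : ‖w‖ ^ 2 = w 0 ^ 2 + w 1 ^ 2 := by
  rw [EuclideanSpace.real_norm_sq_eq, Fin.sum_univ_two]

theorem exists_quarterDisc_le_expectedLoss {a : Attr → ℝ} (ha : ∀ z, 0 < a z)
    {f : Plane → Label} (hf : f ∈ linearClassifiers) :
    ∃ v ∈ quarterDisc, ∀ z, gaussianTail (a z * v z) ≤ expectedLoss (axisMeans a) z f := by
  obtain ⟨w, b, h⟩ := hf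
  obtain rfl : f = linearClassifier w b := funext h
  by_cases hw : w = 0
  · refine ⟨0, ⟨fun z => le_rfl, by simp⟩, fun z => ?_⟩
    have : linearClassifier w b = fun _ => if 0 < b then 1 else 0 := by
      ext x; simp [linearClassifier, hw]
    rw [this, expectedLoss_const]
    simp [gaussianTail_zero]
  · have hn : 0 < ‖w‖ := norm_pos_iff.2 hw
    set u : Plane := ‖w‖⁻¹ • w
    have hu : ‖u‖ = 1 := by rw [norm_smul, norm_inv, norm_norm, inv_mul_cancel₀ hn.ne']
    have heq : linearClassifier w b = linearClassifier u (‖w‖⁻¹ * b) := by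
      ext x
      have : inner ℝ u x + ‖w‖⁻¹ * b = ‖w‖⁻¹ * (inner ℝ w x + b) := by
        rw [real_inner_smul_left]; ring
      simp [linearClassifier, this, hn]
    refine ⟨fun z => |u z|, ⟨fun z => abs_nonneg _, ?_⟩, fun z => ?_⟩
    · rw [sq_abs, sq_abs, ← norm_sq_plane, hu]; norm_num
    · rw [heq, expectedLoss_axisMeans a z hu]
      refine (gaussianTail_le_midpoint (mul_nonneg (ha z).le (abs_nonneg _)) (‖w‖⁻¹ * b)).trans ?_
      have : a z * u z ≤ a z * |u z| := mul_le_mul_of_nonneg_left (le_abs_self _) (ha z).le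
      gcongr <;> exact strictAnti_gaussianTail.antitone (by linarith)

theorem exists_expectedLoss_le {a : Attr → ℝ} (ha : ∀ z, 0 < a z) {v : Attr → ℝ}
    (hv : v ∈ quarterDisc) :
    ∃ f ∈ linearClassifiers, ∀ z, expectedLoss (axisMeans a) z f ≤ gaussianTail (a z * v z) := by
  have h0 := hv.1 0
  have hr : 0 ≤ 1 - v 0 ^ 2 := by have := hv.2; nlinarith [sq_nonneg (v 1)]
  let w : Plane := !₂[v 0, √(1 - v 0 ^ 2)]
  have hw : ‖w‖ = 1 := by
    have : ‖w‖ ^ 2 = 1 := by rw [norm_sq_plane]; simp [w, Real.sq_sqrt hr]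
    nlinarith [norm_nonneg w]
  refine ⟨_, linearClassifier_mem w 0, fun z => ?_⟩
  rw [expectedLoss_axisMeans a z hw, add_zero, sub_zero, add_self_div_two]
  refine strictAnti_gaussianTail.antitone (mul_le_mul_of_nonneg_left ?_ (ha z).le)
  fin_cases z
  · simp [w]
  · simpa [w] using Real.le_sqrt_of_sq_le (by linarith [hv.2])

theorem exists_isOptimalSelection {a : Attr → ℝ} (ha : ∀ z, 0 < a z) :
    ∃ f, IsOptimalSelection (axisMeans a) f := by
  have key (π : Attr → ℝ) (hπ : π ∈ stdSimplex ℝ Attr) :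
      ∃ f, IsOptimalClassifier (axisMeans a) π f := by
    have hcomp : IsCompact quarterDisc := by
      refine IsCompact.of_isClosed_subset (isCompact_univ_pi fun _ : Attr =>
        isCompact_Icc (a := (0 : ℝ)) (b := 1)) ?_ fun v hv z _ => ⟨hv.1 z, ?_⟩
      · have h1 : IsClosed {v : Attr → ℝ | ∀ z, 0 ≤ v z} := by
          simp only [Set.ofPred_forall]
          exact isClosed_iInter fun z => isClosed_le continuous_const (continuous_apply z)
        exact h1.inter (isClosed_le (f := fun v : Attr → ℝ => v 0 ^ 2 + v 1 ^ 2) (by fun_prop)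
          continuous_const)
      · have : v z ^ 2 ≤ 1 := by
          fin_cases z
          · exact le_trans (le_add_of_nonneg_right (sq_nonneg (v 1))) hv.2
          · exact le_trans (le_add_of_nonneg_left (sq_nonneg (v 0))) hv.2
        nlinarith [hv.1 z]
    have hcont : Continuous fun v : Attr → ℝ => ∑ z, π z * gaussianTail (a z * v z) :=
      continuous_finsetSum _ fun z _ =>
        continuous_const.mul (continuous_gaussianTail.comp (by fun_prop))
    obtain ⟨v, hv, hmin⟩ := hcomp.exists_isMinOn
      ⟨0, fun z => le_rfl, by simp⟩ hcont.continuousOn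
    obtain ⟨f, hf, hle⟩ := exists_expectedLoss_le ha hv
    refine ⟨f, hf, fun g hg => ?_⟩
    obtain ⟨u, hu, hge⟩ := exists_quarterDisc_le_expectedLoss ha hg
    calc mixtureLoss (axisMeans a) π f ≤ ∑ z, π z * gaussianTail (a z * v z) :=
          Finset.sum_le_sum fun z _ => mul_le_mul_of_nonneg_left (hle z) (hπ.1 z)
      _ ≤ ∑ z, π z * gaussianTail (a z * u z) := isMinOn_iff.1 hmin u hu
      _ ≤ mixtureLoss (axisMeans a) π g :=
          Finset.sum_le_sum fun z _ => mul_le_mul_of_nonneg_left (hge z) (hπ.1 z)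
  choose! f hf using key
  exact ⟨f, hf⟩

/-! ### The fair optimum -/

/-- The margin shared by both attributes at the point of the unit circle that equalizes them. -/
noncomputable def fairMargin (a : Attr → ℝ) : ℝ := a 0 * a 1 / √(a 0 ^ 2 + a 1 ^ 2)

theorem fairMargin_pos {a : Attr → ℝ} (ha : ∀ z, 0 < a z) : 0 < fairMargin a := by
  have := ha 0
  have := ha 1
  unfold fairMargin
  positivity

theorem le_worstLoss {a : Attr → ℝ} (ha : ∀ z, 0 < a z) {f : Plane → Label}
    (hf : f ∈ linearClassifiers) : gaussianTail (fairMargin a) ≤ worstLoss (axisMeans a) f := by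
  obtain ⟨v, hv, hle⟩ := exists_quarterDisc_le_expectedLoss ha hf
  have h0 := ha 0
  have h1 := ha 1
  -- Otherwise both margins exceed the fair one, and `v` leaves the unit disc.
  by_contra! hlt
  rw [worstLoss, max_lt_iff] at hlt
  have m0 := strictAnti_gaussianTail.lt_iff_gt.1 ((hle 0).trans_lt hlt.1)
  have m1 := strictAnti_gaussianTail.lt_iff_gt.1 ((hle 1).trans_lt hlt.2)
  have hs : 0 < √(a 0 ^ 2 + a 1 ^ 2) := by positivity
  have hq : √(a 0 ^ 2 + a 1 ^ 2) ^ 2 = a 0 ^ 2 + a 1 ^ 2 := Real.sq_sqrt (by positivity)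
  rw [fairMargin, div_lt_iff₀ hs] at m0 m1
  have k0 : a 1 < v 0 * √(a 0 ^ 2 + a 1 ^ 2) := lt_of_mul_lt_mul_left (by linarith) h0.le
  have k1 : a 0 < v 1 * √(a 0 ^ 2 + a 1 ^ 2) := lt_of_mul_lt_mul_left (by linarith) h1.le
  have := hv.2
  have e : (v 0 * √(a 0 ^ 2 + a 1 ^ 2)) ^ 2 + (v 1 * √(a 0 ^ 2 + a 1 ^ 2)) ^ 2
      = (v 0 ^ 2 + v 1 ^ 2) * (a 0 ^ 2 + a 1 ^ 2) := by rw [mul_pow, mul_pow, hq]; ring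
  have p0 := pow_lt_pow_left₀ k0 h1.le two_ne_zero
  have p1 := pow_lt_pow_left₀ k1 h0.le two_ne_zero
  nlinarith [sq_nonneg (a 0), sq_nonneg (a 1)]

/-- The mixture under which the equalizing classifier is optimal. -/
noncomputable def fairMixture (a : Attr → ℝ) : Attr → ℝ :=
  ![a 1 ^ 2 / (a 0 ^ 2 + a 1 ^ 2), a 0 ^ 2 / (a 0 ^ 2 + a 1 ^ 2)]

theorem fairMixture_mem {a : Attr → ℝ} (ha : ∀ z, 0 < a z) :
    fairMixture a ∈ stdSimplex ℝ Attr := by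
  have := ha 0
  refine ⟨fun z => ?_, ?_⟩
  · fin_cases z <;> simp [fairMixture] <;> positivity
  · simp only [Fin.sum_univ_two, fairMixture, Matrix.cons_val_zero, Matrix.cons_val_one]
    field_simp
    ring

/-- The fair mixture weighs the margins so that, by Cauchy–Schwarz, their mean is at most the fair
margin. -/
theorem fairMixture_margin_le {a : Attr → ℝ} (ha : ∀ z, 0 < a z) {v : Attr → ℝ}
    (hv : v ∈ quarterDisc) : ∑ z, fairMixture a z * (a z * v z) ≤ fairMargin a := by
  have h0 := ha 0
  have h1 := ha 1
  have hs : 0 < √(a 0 ^ 2 + a 1 ^ 2) := by positivity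
  have hq : √(a 0 ^ 2 + a 1 ^ 2) ^ 2 = a 0 ^ 2 + a 1 ^ 2 := Real.sq_sqrt (by positivity)
  have hcs : a 1 * v 0 + a 0 * v 1 ≤ √(a 0 ^ 2 + a 1 ^ 2) := by
    refine Real.le_sqrt_of_sq_le ?_
    have := hv.2
    nlinarith [sq_nonneg (a 1 * v 1 - a 0 * v 0), sq_nonneg (a 0), sq_nonneg (a 1)]
  have e : ∑ z, fairMixture a z * (a z * v z)
      = a 0 * a 1 / (a 0 ^ 2 + a 1 ^ 2) * (a 1 * v 0 + a 0 * v 1) := by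
    simp only [Fin.sum_univ_two, fairMixture, Matrix.cons_val_zero, Matrix.cons_val_one]
    field_simp
  have e' : fairMargin a = a 0 * a 1 / (a 0 ^ 2 + a 1 ^ 2) * √(a 0 ^ 2 + a 1 ^ 2) := by
    rw [fairMargin]
    field_simp
    exact hq.symm
  rw [e, e']
  gcongr

/-- Equality holds in the tangent bound only at the fair margin, so every optimal classifier for
the fair mixture has the same loss on both attributes. -/
theorem worstLoss_eq_of_isOptimalClassifier_fairMixture {a : Attr → ℝ} (ha : ∀ z, 0 < a z)
    {f : Plane → Label} (hf : IsOptimalClassifier (axisMeans a) (fairMixture a) f) :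
    worstLoss (axisMeans a) f = gaussianTail (fairMargin a) := by
  have h0 := ha 0
  have h1 := ha 1
  set s := fairMargin a with hsdef
  have hs0 : 0 < s := fairMargin_pos ha
  have hr : 0 < √(a 0 ^ 2 + a 1 ^ 2) := by positivity
  have hq : √(a 0 ^ 2 + a 1 ^ 2) ^ 2 = a 0 ^ 2 + a 1 ^ 2 := Real.sq_sqrt (by positivity)
  have hsum : fairMixture a 0 + fairMixture a 1 = 1 := by
    simpa [Fin.sum_univ_two] using (fairMixture_mem ha).2
  have hp0 : 0 < fairMixture a 0 := by simp [fairMixture]; positivity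
  have hp1 : 0 < fairMixture a 1 := by simp [fairMixture]; positivity
  obtain ⟨v, hv, hle⟩ := exists_quarterDisc_le_expectedLoss ha hf.1
  have hmarg := fairMixture_margin_le ha hv
  rw [Fin.sum_univ_two, ← hsdef] at hmarg
  -- The equalizing classifier bounds the optimal mixture loss from above.
  have hupper : mixtureLoss (axisMeans a) (fairMixture a) f ≤ gaussianTail s := by
    have hu : ![a 1 / √(a 0 ^ 2 + a 1 ^ 2), a 0 / √(a 0 ^ 2 + a 1 ^ 2)] ∈ quarterDisc := by
      refine ⟨fun z => by fin_cases z <;> simp <;> positivity, le_of_eq ?_⟩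
      simp only [Matrix.cons_val_zero, Matrix.cons_val_one, div_pow, hq]
      field_simp
      ring
    obtain ⟨g, hg, hgle⟩ := exists_expectedLoss_le ha hu
    have g0 := hgle 0
    have g1 := hgle 1
    have e0 : a 0 * (a 1 / √(a 0 ^ 2 + a 1 ^ 2)) = s := by rw [hsdef, fairMargin]; ring
    have e1 : a 1 * (a 0 / √(a 0 ^ 2 + a 1 ^ 2)) = s := by rw [hsdef, fairMargin]; ring
    simp only [Matrix.cons_val_zero, Matrix.cons_val_one, e0, e1] at g0 g1
    refine (hf.2 g hg).trans ?_
    rw [mixtureLoss, Fin.sum_univ_two]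
    calc _ ≤ fairMixture a 0 * gaussianTail s + fairMixture a 1 * gaussianTail s := by gcongr
      _ = gaussianTail s := by rw [← add_mul, hsum, one_mul]
  rw [mixtureLoss, Fin.sum_univ_two] at hupper
  have l0 := hle 0
  have l1 := hle 1
  have hφ : 0 < gaussianPDFReal 0 1 s := gaussianPDFReal_pos 0 1 s one_ne_zero
  have n0 : 0 ≤ a 0 * v 0 := mul_nonneg h0.le (hv.1 0)
  have n1 : 0 ≤ a 1 * v 1 := mul_nonneg h1.le (hv.1 1)
  have t0 := tangent_le_gaussianTail hs0.le n0
  have t1 := tangent_le_gaussianTail hs0.le n1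
  have hbase : 0 ≤ gaussianPDFReal 0 1 s *
      (s - (fairMixture a 0 * (a 0 * v 0) + fairMixture a 1 * (a 1 * v 1))) :=
    mul_nonneg hφ.le (by linarith)
  have m0 : a 0 * v 0 = s := by
    by_contra hne
    have t := tangent_lt_gaussianTail hs0.le n0 hne
    have k0 := mul_lt_mul_of_pos_left (t.trans_le l0) hp0
    have k1 := mul_le_mul_of_nonneg_left (t1.trans l1) hp1.le
    have e : fairMixture a 1 = 1 - fairMixture a 0 := by linarith
    rw [e] at k1 hupper hbase
    linarith
  have m1 : a 1 * v 1 = s := by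
    by_contra hne
    have t := tangent_lt_gaussianTail hs0.le n1 hne
    have k0 := mul_le_mul_of_nonneg_left (t0.trans l0) hp0.le
    have k1 := mul_lt_mul_of_pos_left (t.trans_le l1) hp1
    have e : fairMixture a 1 = 1 - fairMixture a 0 := by linarith
    rw [e] at k1 hupper hbase
    linarith
  rw [m0] at l0
  rw [m1] at l1
  have k0 := mul_le_mul_of_nonneg_left l0 hp0.le
  have k1 := mul_le_mul_of_nonneg_left l1 hp1.le
  have e : (fairMixture a 0 + fairMixture a 1) * gaussianTail s = gaussianTail s := by
    rw [hsum, one_mul]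
  refine le_antisymm (max_le ?_ ?_) (le_worstLoss ha hf.1)
  · exact le_of_mul_le_mul_left (by linarith) hp0
  · exact le_of_mul_le_mul_left (by linarith) hp1

theorem isFairestMixture_fairMixture {a : Attr → ℝ} (ha : ∀ z, 0 < a z)
    {f : (Attr → ℝ) → Plane → Label} (hf : IsOptimalSelection (axisMeans a) f) :
    IsFairestMixture (axisMeans a) f (fairMixture a) := by
  refine ⟨fairMixture_mem ha, fun π hπ => ?_⟩
  rw [worstLoss_eq_of_isOptimalClassifier_fairMixture ha (hf _ (fairMixture_mem ha))]
  exact le_worstLoss ha (hf π hπ).1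

theorem IsFairestMixture.worstLoss_eq {a : Attr → ℝ} (ha : ∀ z, 0 < a z)
    {f : (Attr → ℝ) → Plane → Label} (hf : IsOptimalSelection (axisMeans a) f) {π : Attr → ℝ}
    (hπ : IsFairestMixture (axisMeans a) f π) :
    worstLoss (axisMeans a) (f π) = gaussianTail (fairMargin a) := by
  refine le_antisymm ?_ (le_worstLoss ha (hf π hπ.1).1)
  rw [← worstLoss_eq_of_isOptimalClassifier_fairMixture ha (hf _ (fairMixture_mem ha))]
  exact hπ.2 _ (fairMixture_mem ha)

/-! ### The cost of undersampling the harder attribute -/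

/-- If the attribute `z` has the weaker signal but no more than half of the weight, an optimal
classifier does not favour it: otherwise, swapping the two coordinates would reduce the mixture
loss. -/
theorem le_expectedLoss_of_weight_le {a : Attr → ℝ} (ha : ∀ z, 0 < a z) {z z' : Attr}
    (hz : z ≠ z') (hlt : a z < a z') (hle : a z' ≤ 1) {π : Attr → ℝ}
    (hπ : π ∈ stdSimplex ℝ Attr) (hw : π z ≤ π z') {f : Plane → Label}
    (hf : IsOptimalClassifier (axisMeans a) π f) :
    gaussianTail (a z * (1 / √2)) ≤ expectedLoss (axisMeans a) z f := by
  have sum_eq (F : Attr → ℝ) : F z + F z' = ∑ i, F i := by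
    have huniv : ∀ z z' : Attr, z ≠ z' → {z, z'} = Finset.univ := by decide
    rw [← Finset.sum_pair hz, huniv z z' hz]
  obtain ⟨v, hv, hvle⟩ := exists_quarterDisc_le_expectedLoss ha hf.1
  by_contra! hbad
  have hm := lt_of_mul_lt_mul_left
    (strictAnti_gaussianTail.lt_iff_gt.1 ((hvle z).trans_lt hbad)) (ha z).le
  have hdisc : v z ^ 2 + v z' ^ 2 ≤ 1 := by
    rw [sum_eq fun i => v i ^ 2, Fin.sum_univ_two]
    exact hv.2
  have h2 : (1 / √2) ^ 2 = (1 / 2 : ℝ) := by rw [div_pow, Real.sq_sqrt (by norm_num)]; norm_num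
  have hv0 := hv.1 z
  have hv0' := hv.1 z'
  have hsq : (1 / 2 : ℝ) < v z ^ 2 := by rw [← h2]; gcongr
  have hvlt : v z' < v z := by nlinarith
  have hswap : (fun i => v (Equiv.swap z z' i)) ∈ quarterDisc := by
    refine ⟨fun i => hv.1 _, ?_⟩
    have := sum_eq fun i => v (Equiv.swap z z' i) ^ 2
    simp only [Equiv.swap_apply_left, Equiv.swap_apply_right, Fin.sum_univ_two] at this
    linarith
  obtain ⟨g, hg, hgle⟩ := exists_expectedLoss_le ha hswap
  have g0 := hgle z
  have g1 := hgle z'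
  simp only [Equiv.swap_apply_left, Equiv.swap_apply_right] at g0 g1
  have hopt := hf.2 g hg
  rw [mixtureLoss, mixtureLoss, ← sum_eq, ← sum_eq] at hopt
  have hgain := gaussianTail_gain_lt (ha z) hlt hv0' hvlt
    (by nlinarith [ha z'] : a z' * v z ≤ 1)
  have hpos : 0 < π z' := by
    have h1 : π z + π z' = 1 := (sum_eq π).trans hπ.2
    linarith
  have ha' := strictAnti_gaussianTail.antitone (mul_le_mul_of_nonneg_left hvlt.le (ha z).le)
  have p0 := mul_le_mul_of_nonneg_left (hvle z) (hπ.1 z)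
  have p1 := mul_le_mul_of_nonneg_left (hvle z') hpos.le
  have q0 := mul_le_mul_of_nonneg_left g0 (hπ.1 z)
  have q1 := mul_le_mul_of_nonneg_left g1 hpos.le
  have r0 := mul_le_mul_of_nonneg_right hw (sub_nonneg.2 ha')
  have r1 := mul_lt_mul_of_pos_left hgain hpos
  linarith

theorem expectedLoss_le_worstLoss (m : MeanVectors) (z : Attr) (f : Plane → Label) :
    expectedLoss m z f ≤ worstLoss m f := by
  fin_cases z
  · exact le_max_left _ _
  · exact le_max_right _ _

/-! ### Lower bounds on the excess risk and the two-point argument -/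

/-- When the signals `1 / 2` and `1 / 2 + ε` differ, the fair margin beats the margin of the
harder attribute at the diagonal classifier by a constant times `ε`. -/
theorem fairMargin_sub_ge {a : Attr → ℝ} {z z' : Attr} (hz : z ≠ z') {ε : ℝ} (h0 : 0 < ε)
    (h1 : ε ≤ 1 / 2) (ha : a z = 1 / 2) (ha' : a z' = 1 / 2 + ε) :
    ε / 10 ≤ fairMargin a - a z * (1 / √2) := by
  have e : fairMargin a = 1 / 2 * (1 / 2 + ε) / √((1 / 2) ^ 2 + (1 / 2 + ε) ^ 2) := by
    have : (z = 0 ∧ z' = 1) ∨ (z = 1 ∧ z' = 0) := by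
      clear ha ha'
      revert z z'
      decide
    rcases this with ⟨rfl, rfl⟩ | ⟨rfl, rfl⟩
    · rw [fairMargin, ha, ha']
    · rw [fairMargin, ha, ha', mul_comm, add_comm ((1 / 2 + ε) ^ 2)]
  set r := √((1 / 2) ^ 2 + (1 / 2 + ε) ^ 2)
  have hr : 0 < r := by positivity
  have hr2 : r ^ 2 = (1 / 2) ^ 2 + (1 / 2 + ε) ^ 2 := Real.sq_sqrt (by positivity)
  have hq : 0 < √(2 : ℝ) := by positivity
  have hq2 : √(2 : ℝ) ^ 2 = 2 := Real.sq_sqrt (by norm_num)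
  have hr' : r ≤ 1.12 := by nlinarith
  have hq' : √(2 : ℝ) ≤ 1.42 := by nlinarith
  have hqr : √2 * r ≤ 1.6 := by nlinarith
  have hB : 0 < √2 * (1 / 2 + ε) + r := by positivity
  -- Multiplied by its conjugate, the numerator `√2 * (1 / 2 + ε) - r` becomes `ε + ε ^ 2`.
  have hconj : (√2 * (1 / 2 + ε) - r) * (√2 * (1 / 2 + ε) + r) = ε + ε ^ 2 := by
    linear_combination (1 / 2 + ε) ^ 2 * hq2 - hr2
  have hnum : ε ≤ (√2 * (1 / 2 + ε) - r) * 2.54 := by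
    have hB' : √2 * (1 / 2 + ε) + r ≤ 2.54 := by nlinarith
    have : 0 < √2 * (1 / 2 + ε) - r := pos_of_mul_pos_left (by rw [hconj]; positivity) hB.le
    nlinarith
  have hsplit : 1 / 2 * (1 / 2 + ε) / r - 1 / 2 * (1 / √2)
      = (√2 * (1 / 2 + ε) - r) / (2 * (√2 * r)) := by
    field_simp
  rw [e, ha, hsplit, le_div_iff₀ (by positivity)]
  nlinarith

theorem measurable_query_trace (n : ℕ) :
    Measurable fun (h : Fin n → Round) (t : Fin n) => (h t).1 := by fun_prop

/-- The counts depend on the history through the queried attributes only, which take finitely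
many values; so no measurability of the selection is needed. -/
theorem integrable_excessRisk (m : MeanVectors) (f : (Attr → ℝ) → Plane → Label) (π' : Attr → ℝ)
    {n : ℕ} (μ : Measure (Fin n → Round)) [IsFiniteMeasure μ] :
    Integrable (fun h : Fin n → Round => excessRisk m f π' h) μ := by
  let F : (Fin n → Attr) → ℝ := fun q => worstLoss m (f fun z =>
    ((Finset.univ.filter fun t => q t = z).card : ℝ) / n) - worstLoss m (f π')
  have hF : Integrable F (μ.map fun h t => (h t).1) := Integrable.of_finite
  exact hF.comp_measurable (measurable_query_trace n)

theorem measurableSet_empiricalMixture_le (n : ℕ) (z z' : Attr) :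
    MeasurableSet {h : Fin n → Round | empiricalMixture h z ≤ empiricalMixture h z'} := by
  exact measurable_query_trace n (MeasurableSet.of_discrete (s := {q : Fin n → Attr |
    ((Finset.univ.filter fun t => q t = z).card : ℝ) / n
      ≤ ((Finset.univ.filter fun t => q t = z').card : ℝ) / n}))

theorem empiricalMixture_mem {n : ℕ} (hn : 1 ≤ n) (h : Fin n → Round) :
    empiricalMixture h ∈ stdSimplex ℝ Attr := by
  refine ⟨fun z => by unfold empiricalMixture; positivity, ?_⟩
  have hn' : (n : ℝ) ≠ 0 := by positivity
  simp only [empiricalMixture]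
  rw [← Finset.sum_div, div_eq_one_iff_eq hn', ← Nat.cast_sum]
  have := Finset.card_eq_sum_card_fiberwise (s := (Finset.univ : Finset (Fin n)))
    (t := (Finset.univ : Finset Attr)) (f := fun t => (h t).1) (fun _ _ => by simp)
  rw [← this]
  simp

/-- The excess risk is at least of order `ε` whenever the harder attribute `z`, whose signal is
weaker by `ε`, gets at most half of the budget. -/
theorem measureReal_mul_le_integral_excessRisk {a : Attr → ℝ} {z z' : Attr} (hz : z ≠ z') {ε : ℝ}
    (h0 : 0 < ε) (h1 : ε ≤ 1 / 2) (ha : a z = 1 / 2) (ha' : a z' = 1 / 2 + ε)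
    {f : (Attr → ℝ) → Plane → Label} (hf : IsOptimalSelection (axisMeans a) f) {π' : Attr → ℝ}
    (hπ : IsFairestMixture (axisMeans a) f π') {n : ℕ} (hn : 1 ≤ n)
    (μ : Measure (Fin n → Round)) [IsFiniteMeasure μ] :
    μ.real {h | empiricalMixture h z ≤ empiricalMixture h z'} *
      (gaussianPDFReal 0 1 1 * (ε / 10)) ≤ ∫ h, excessRisk (axisMeans a) f π' h ∂μ := by
  have huniv : ∀ i, i = z ∨ i = z' := by
    clear ha ha'
    revert z z'
    decide
  have hpos : ∀ i, 0 < a i := by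
    intro i
    rcases huniv i with rfl | rfl
    · rw [ha]; norm_num
    · rw [ha']; linarith
  rw [← smul_eq_mul, ← integral_indicator_const _ (measurableSet_empiricalMixture_le n z z')]
  refine integral_mono_of_nonneg (.of_forall fun h => ?_) (integrable_excessRisk _ _ _ μ)
    (.of_forall fun h => ?_)
  · exact Set.indicator_nonneg (fun _ _ =>
      mul_nonneg (gaussianPDFReal_nonneg _ _ _) (by linarith)) h
  have hmem := empiricalMixture_mem hn h
  simp only [excessRisk, hπ.worstLoss_eq hpos hf]
  by_cases hh : h ∈ {h : Fin n → Round | empiricalMixture h z ≤ empiricalMixture h z'}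
  · rw [Set.indicator_of_mem hh]
    have hloss := (le_expectedLoss_of_weight_le hpos hz (by linarith) (by linarith) hmem hh
      (hf _ hmem)).trans (expectedLoss_le_worstLoss _ z _)
    have hgap := fairMargin_sub_ge hz h0 h1 ha ha'
    have hle1 : fairMargin a ≤ 1 := by
      have p0 := hpos 0
      have p1 := hpos 1
      have q : a 0 ≤ 1 := by rcases huniv 0 with h | h <;> rw [h] <;> linarith
      rw [fairMargin, div_le_one (by positivity)]
      refine Real.le_sqrt_of_sq_le ?_
      nlinarith [mul_le_mul_of_nonneg_right (pow_le_one₀ p0.le q (n := 2)) (sq_nonneg (a 1)),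
        sq_nonneg (a 0)]
    have := stdPDF_one_mul_le_gaussianTail_sub (s := a z * (1 / √2)) (t := fairMargin a)
      (by have := hpos z; positivity) (by linarith) hle1
    have := mul_le_mul_of_nonneg_left hgap (gaussianPDFReal_nonneg 0 1 1)
    linarith
  · rw [Set.indicator_of_notMem hh]
    exact sub_nonneg.2 (le_worstLoss hpos (hf _ hmem).1)

/-- Two-point testing: if `P` is chi-square dominated by `Q` and the events `s` and `t` cover the
space, then `P s` and `Q t` cannot both be small. -/
theorem ChiSqDominated.le_measureReal_or {α : Type*} [MeasurableSpace α] {P Q : Measure α}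
    [IsProbabilityMeasure P] [IsProbabilityMeasure Q] {K : ℝ} (hK : 1 ≤ K)
    (h : ChiSqDominated (ENNReal.ofReal K) P Q) {s t : Set α} (hs : MeasurableSet s)
    (hst : sᶜ ⊆ t) : 1 / (4 * K) ≤ P.real s ∨ 1 / (4 * K) ≤ Q.real t := by
  have hle : 1 / (4 * K) ≤ 1 / 4 := by
    gcongr
    linarith
  by_cases hP : 1 / 2 ≤ P.real s
  · left; linarith
  · right
    have hc : 1 / 2 ≤ P.real sᶜ := by rw [probReal_compl_eq_one_sub hs]; linarith
    have hsq := ENNReal.toReal_mono (by finiteness) (h.sq_measure_le hs.compl)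
    rw [ENNReal.toReal_pow, ENNReal.toReal_mul, ENNReal.toReal_ofReal (by linarith)] at hsq
    change P.real sᶜ ^ 2 ≤ K * Q.real sᶜ at hsq
    have hmono : Q.real sᶜ ≤ Q.real t := measureReal_mono hst
    rw [div_le_iff₀ (by linarith)]
    nlinarith

end FairSampling

open FairSampling in
theorem proposition3 :
    ∃ c : ℝ, 0 < c ∧ ∀ n : ℕ, 1 ≤ n → ∀ A : SamplingScheme, ∃ m : MeanVectors,
      (∃ f : (Attr → ℝ) → Plane → Label, IsOptimalSelection m f) ∧
      ∀ f : (Attr → ℝ) → Plane → Label, IsOptimalSelection m f →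
        (∃ π' : Attr → ℝ, IsFairestMixture m f π') ∧
        ∀ π' : Attr → ℝ, IsFairestMixture m f π' →
          Integrable (fun h : Fin n → Round => excessRisk m f π' h) (historyLaw m A n) ∧
          c / √(n : ℝ) ≤ ∫ h : Fin n → Round, excessRisk m f π' h ∂(historyLaw m A n) := by
  have hφ := gaussianPDFReal_pos 0 1 1 one_ne_zero
  set K := Real.exp (1 / 4)
  have hK : 1 ≤ K := Real.one_le_exp (by norm_num)
  refine ⟨1 / (4 * K) * (gaussianPDFReal 0 1 1 * (1 / 20)), by positivity, fun n hn A => ?_⟩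
  have hn1 : (1 : ℝ) ≤ n := by exact_mod_cast hn
  have hs1 : 1 ≤ √(n : ℝ) := Real.one_le_sqrt.2 hn1
  set ε : ℝ := 1 / (2 * √(n : ℝ)) with hε
  have h0 : 0 < ε := by positivity
  have h1 : ε ≤ 1 / 2 := by rw [hε]; gcongr; linarith
  -- The two candidate instances differ in the attribute that has the weaker signal.
  let a : Attr → ℝ := ![1 / 2, 1 / 2 + ε]
  let a' : Attr → ℝ := ![1 / 2 + ε, 1 / 2]
  have hdom : ChiSqDominated (ENNReal.ofReal K) (historyLaw (axisMeans a) A n)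
      (historyLaw (axisMeans a') A n) := by
    have hz (z : Attr) : ChiSqDominated (ENNReal.ofReal (Real.exp (ε ^ 2)))
        (sampleLaw (axisMeans a) z) (sampleLaw (axisMeans a') z) := by
      refine chiSqDominated_sampleLaw fun y => le_of_eq ?_
      rw [norm_sq_plane]
      fin_cases z <;> fin_cases y <;> simp [axisMeans, a, a']
    have := chiSqDominated_historyLaw hz A n
    rw [← ENNReal.ofReal_pow (Real.exp_nonneg _), ← Real.exp_nat_mul] at this
    convert this using 4
    rw [hε, div_pow, mul_pow, Real.sq_sqrt (by linarith)]
    field_simp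
    norm_num
  have hcover : {h : Fin n → Round | empiricalMixture h 0 ≤ empiricalMixture h 1}ᶜ
      ⊆ {h | empiricalMixture h 1 ≤ empiricalMixture h 0} := fun h hh =>
    (le_total (empiricalMixture h 0) _).resolve_left fun hle => hh hle
  have concl (b : Attr → ℝ) (z z' : Attr) (hz : z ≠ z') (hb : b z = 1 / 2)
      (hb' : b z' = 1 / 2 + ε) (hpos : ∀ i, 0 < b i)
      (hp : 1 / (4 * K) ≤ (historyLaw (axisMeans b) A n).real
        {h | empiricalMixture h z ≤ empiricalMixture h z'}) :
      (∃ f : (Attr → ℝ) → Plane → Label, IsOptimalSelection (axisMeans b) f) ∧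
      ∀ f : (Attr → ℝ) → Plane → Label, IsOptimalSelection (axisMeans b) f →
        (∃ π' : Attr → ℝ, IsFairestMixture (axisMeans b) f π') ∧
        ∀ π' : Attr → ℝ, IsFairestMixture (axisMeans b) f π' →
          Integrable (fun h : Fin n → Round => excessRisk (axisMeans b) f π' h)
            (historyLaw (axisMeans b) A n) ∧
          1 / (4 * K) * (gaussianPDFReal 0 1 1 * (1 / 20)) / √(n : ℝ) ≤
            ∫ h : Fin n → Round, excessRisk (axisMeans b) f π' h
              ∂(historyLaw (axisMeans b) A n) := by
    refine ⟨exists_isOptimalSelection hpos, fun f hf =>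
      ⟨⟨_, isFairestMixture_fairMixture hpos hf⟩, fun π' hπ =>
        ⟨integrable_excessRisk _ _ _ _, ?_⟩⟩⟩
    refine le_trans ?_ (measureReal_mul_le_integral_excessRisk hz h0 h1 hb hb' hf hπ hn _)
    calc _ = 1 / (4 * K) * (gaussianPDFReal 0 1 1 * (ε / 10)) := by rw [hε]; field_simp; norm_num
      _ ≤ _ := by gcongr
  rcases hdom.le_measureReal_or hK (measurableSet_empiricalMixture_le n 0 1) hcover with hp | hp
  · exact ⟨axisMeans a, concl a 0 1 (by decide) rfl rfl
      (fun i => by fin_cases i <;> (simp [a]; try positivity)) hp⟩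
  · exact ⟨axisMeans a', concl a' 1 0 (by decide) rfl rfl
      (fun i => by fin_cases i <;> (simp [a']; try positivity)) hp⟩
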